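/- Let $d$ be an odd prime, $n\ge 0$ an integer, and $\omega=e^{2\pi i/d}$. Let $\mathbb{C}^d$ have the orthonormal basis $\{|j\rangle : j\in\mathbb{Z}/d\mathbb{Z}\}$. Define one-qudit operators $$X|j\rangle=|j+1\rangle,\qquad Z|j\rangle=\omega^{j}|j\rangle,\qquad F|j\rangle=\tfrac{1}{\sqrt d}\sum_{m\in\mathbb{Z}/d\mathbb{Z}}\omega^{jm}|m\rangle,\qquad S|j\rangle=\omega^{j(j+1)/2}|j\rangle,$$ and the two-qudit operator $C_X|j\rangle|k\rangle=|j\rangle|j+k\rangle$. Let $\mathcal{P}_d=\langle X,Z\rangle$ be the group generated by $X$ and $Z$, let $\mathcal{P}_d^n=\{p_1\otimes\cdots\otimes p_n : p_k\in\mathcal{P}_d\}$ be the generalised Pauli group on $n$ qudits, and let $$\mathcal{C}_d^n=\{N\in U(d^n) : \forall A\in\mathcal{P}_d^n\ \exists A'\in\mathcal{P}_d^n,\ c\in\mathbb{C}\ \text{such that}\ NAN^\dagger=cA'\}$$ be the Clifford group on $n$ qudits. A circuit over $\{C_X,F,S\}$ is a finite (possibly empty) product of operators on $(\mathbb{C}^d)^{\otimes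 n}$, each of which is $F$ or $S$ acting on one qudit, or $C_X$ acting on an ordered pair (control, target) of distinct qudits, and as the identity on all other qudits. Then, up to a global phase, the Clifford group on $n$ qudits is generated by $\{C_X,F,S\}$: an operator $U$ on $(\mathbb{C}^d)^{\otimes n}$ belongs to $\mathcal{C}_d^n$ if and only if $U=cC$ for some $c\in\mathbb{C}$ with $|c|=1$ and some circuit $C$ over $\{C_X,F,S\}$. The same equivalence holds for circuits in which $C_X$ is applied only to neighbouring qudits, with control $i$ and target $i+1$. -/

import Mathlib

open scoped Matrix

noncomputable section

namespace Qudit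

/-- The primitive `d`-th root of unity `ω = exp (2πi/d)`. -/
def omega (d : ℕ) : ℂ := Complex.exp (2 * Real.pi * Complex.I / d)

/-- One-qudit operators: matrices in the computational basis `|j⟩`, `j ∈ ℤ/d`.
The entry `A a b` is `⟨a| A |b⟩`, so column `b` is the image of `|b⟩`. -/
abbrev Op1 (d : ℕ) : Type := Matrix (ZMod d) (ZMod d) ℂ

/-- Operators on `n` qudits: matrices in the computational basis
`|x₁⟩ ⊗ ⋯ ⊗ |xₙ⟩`, `x ∈ (ℤ/d)ⁿ`, of the `dⁿ`-dimensional space. -/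
abbrev Op (d n : ℕ) : Type := Matrix (Fin n → ZMod d) (Fin n → ZMod d) ℂ

/-- `X |j⟩ = |j + 1⟩`. -/
def matX (d : ℕ) : Op1 d := Matrix.of fun a j => if a = j + 1 then 1 else 0

/-- `Z |j⟩ = ω ^ j |j⟩`. -/
def matZ (d : ℕ) : Op1 d := Matrix.diagonal fun j => omega d ^ j.val

/-- The Fourier gate `F |j⟩ = (1/√d) ∑ₘ ω ^ (j m) |m⟩`. -/
def matF (d : ℕ) : Op1 d :=
  Matrix.of fun m j => ((Real.sqrt d : ℝ) : ℂ)⁻¹ * omega d ^ (j.val * m.val)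

/-- The phase gate `S |j⟩ = ω ^ (j (j + 1) / 2) |j⟩` (the natural-number division is exact). -/
def matS (d : ℕ) : Op1 d :=
  Matrix.diagonal fun j => omega d ^ (j.val * (j.val + 1) / 2)

/-- The two-qudit gate `C_X |j⟩|k⟩ = |j⟩|j + k⟩`. -/
def matCX (d : ℕ) : Matrix (ZMod d × ZMod d) (ZMod d × ZMod d) ℂ :=
  Matrix.of fun a b => if a = (b.1, b.1 + b.2) then 1 else 0

theorem star_omega_mul (d : ℕ) : star (omega d) * omega d = 1 := by
  rw [omega, Complex.star_def, ← Complex.exp_conj, ← Complex.exp_add]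
  have h : (starRingEnd ℂ) (2 * Real.pi * Complex.I / d) = -(2 * Real.pi * Complex.I / d) := by
    rw [map_div₀, map_mul, map_mul, Complex.conj_I, Complex.conj_ofReal, map_natCast,
      map_ofNat]
    ring
  rw [h, neg_add_cancel, Complex.exp_zero]

theorem matX_mem (d : ℕ) [NeZero d] : matX d ∈ Matrix.unitaryGroup (ZMod d) ℂ := by
  rw [Matrix.mem_unitaryGroup_iff']
  ext i j
  simp [matX, Matrix.mul_apply, Matrix.star_apply, Matrix.one_apply, apply_ite]
  split_ifs with h
  · exact h.symm
  · exact fun h' => h h'.symm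

theorem matZ_mem (d : ℕ) [NeZero d] : matZ d ∈ Matrix.unitaryGroup (ZMod d) ℂ := by
  rw [Matrix.mem_unitaryGroup_iff', matZ, Matrix.star_eq_conjTranspose,
    Matrix.diagonal_conjTranspose, Matrix.diagonal_mul_diagonal, ← Matrix.diagonal_one]
  congr 1
  funext j
  rw [Pi.star_apply, star_pow, ← mul_pow, star_omega_mul, one_pow]

/-- The one-qudit Pauli group: the group generated by `X` and `Z`. -/
def pauliOne (d : ℕ) [NeZero d] : Subgroup (Matrix.unitaryGroup (ZMod d) ℂ) :=
  Subgroup.closure {⟨matX d, matX_mem d⟩, ⟨matZ d, matZ_mem d⟩}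

/-- The tensor product `p₁ ⊗ ⋯ ⊗ pₙ` of one-qudit operators. -/
def tensor {d n : ℕ} (p : Fin n → Op1 d) : Op d n :=
  Matrix.of fun x y => ∏ k, p k (x k) (y k)

/-- The `n`-qudit Pauli group: all `p₁ ⊗ ⋯ ⊗ pₙ` with each `pₖ` in the one-qudit Pauli group. -/
def pauli (d n : ℕ) [NeZero d] : Set (Op d n) :=
  {A | ∃ p : Fin n → Matrix.unitaryGroup (ZMod d) ℂ,
    (∀ k, p k ∈ pauliOne d) ∧ A = tensor fun k => (p k : Op1 d)}

/-- The normaliser up to phase of a set `G` of matrices, within the unitary group. -/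
def phaseNormalizer {ι : Type*} [Fintype ι] [DecidableEq ι] (G : Set (Matrix ι ι ℂ)) :
    Set (Matrix ι ι ℂ) :=
  {N | N ∈ Matrix.unitaryGroup ι ℂ ∧ ∀ A ∈ G, ∃ A' ∈ G, ∃ c : ℂ, N * A * Nᴴ = c • A'}

/-- The `n`-qudit Clifford group. -/
def clifford (d n : ℕ) [NeZero d] : Set (Op d n) := phaseNormalizer (pauli d n)

/-- The gate `g` applied to qudit `i`, the identity on all other qudits. -/
def onQudit {d n : ℕ} (i : Fin n) (g : Op1 d) : Op d n :=
  tensor (Function.update (fun _ => 1) i g)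

/-- The two-qudit gate `g` applied to the qudits `i` (first) and `j` (second),
the identity on all other qudits; meant for `i ≠ j`. -/
def onPair {d n : ℕ} (i j : Fin n) (g : Matrix (ZMod d × ZMod d) (ZMod d × ZMod d) ℂ) :
    Op d n :=
  Matrix.of fun x y =>
    if ∀ k, k ≠ i → k ≠ j → x k = y k then g (x i, x j) (y i, y j) else 0

/-- The elementary steps of circuits over `{C_X, F, S}` on `n` qudits: `F` or `S` on any one
qudit, and `C_X` with control `i` and target `j` for any `i ≠ j` with `E i j`. -/
def gates (d n : ℕ) (E : Fin n → Fin n → Prop) : Set (Op d n) :=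
  {U | (∃ i, U = onQudit i (matF d)) ∨ (∃ i, U = onQudit i (matS d)) ∨
    ∃ i j, i ≠ j ∧ E i j ∧ U = onPair i j (matCX d)}

/-- The operators computed by circuits: finite (possibly empty) products of gates,
without inverses. -/
def circuits (d n : ℕ) [NeZero d] (E : Fin n → Fin n → Prop) : Submonoid (Op d n) :=
  Submonoid.closure (gates d n E)

/-- The operators that agree, up to a global phase, with an operator computed by a circuit. -/
def circuitsUpToPhase (d n : ℕ) [NeZero d] (E : Fin n → Fin n → Prop) : Set (Op d n) :=
  {U | ∃ c : ℂ, ‖c‖ = 1 ∧ ∃ C ∈ circuits d n E, U = c • C}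

end Qudit

end

/-! Up to scalars, Pauli operators are the Weyl operators X^a Z^b, indexed by phase space (ℤ/d)ⁿ ×
(ℤ/d)ⁿ. Conjugation by a Clifford operator therefore permutes phase space, and it preserves the
symplectic form because that form records the phase in the commutation of two Weyl operators. Each
gate acts this way, so circuits are Clifford.

For the converse, the linear maps implemented by circuits form a group containing many
transvections. S on qudit i is a transvection along the i-th Z-direction; conjugating by F gives the
i-th X-direction, and conjugating by C_X gives sums x_i + x_j. If transvections along u are
available and u, v are not orthogonal, those along v and along v + u are available together
(`HasTransv.add_iff`). Such additions link all nonzero vectors, so every transvection is available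
(`hasTransv_of_generators`); neighbouring pairs already suffice.

Transvections move any symplectic family to the standard one (`exists_mem_map_standard`, a Witt-type
argument). Hence some circuit C acts on the standard basis as the given Clifford U does, and C†U
fixes every Weyl operator up to phase. Such a unitary is a multiple of a Weyl operator
(`exists_eq_smul_weyl_of_maps_self`), which is itself a circuit (`weyl_mem_circuits`). -/

namespace Qudit

/-! ### Weyl operators, phase space and the symplectic form -/

section Operators

variable {d n : ℕ}

/-- The standard additive character `j ↦ ω ^ j` of `ℤ/d`. -/
noncomputable abbrev chi (d : ℕ) [NeZero d] : AddChar (ZMod d) ℂ := ZMod.stdAddChar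

theorem omega_pow [NeZero d] (k : ℕ) : omega d ^ k = chi d (k : ZMod d) := by
  have h := ZMod.stdAddChar_coe (N := d) (k : ℤ)
  rw [omega, ← Complex.exp_nat_mul]
  push_cast at h
  rw [h]
  congr 1
  ring

theorem omega_pow_val [NeZero d] (j : ZMod d) : omega d ^ j.val = chi d j := by
  rw [omega_pow, ZMod.natCast_zmod_val]

theorem star_chi [NeZero d] (a : ZMod d) : star (chi d a) = chi d (-a) := by
  rw [AddChar.map_neg_eq_conj]
  rfl

theorem chi_ne_zero [NeZero d] (a : ZMod d) : chi d a ≠ 0 := by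
  intro h
  have h1 : chi d (a + -a) = 1 := by simp
  rw [AddChar.map_add_eq_mul, h, zero_mul] at h1
  exact zero_ne_one h1

theorem chi_sum [NeZero d] {ι : Type*} (s : Finset ι) (f : ι → ZMod d) :
    chi d (∑ i ∈ s, f i) = ∏ i ∈ s, chi d (f i) := by
  classical
  induction s using Finset.induction_on with
  | empty => simp
  | insert i s hi ih =>
    rw [Finset.sum_insert hi, Finset.prod_insert hi, AddChar.map_add_eq_mul, ih]

theorem sum_chi_mul [NeZero d] (a : ZMod d) :
    ∑ k : ZMod d, chi d (k * a) = if a = 0 then (d : ℂ) else 0 := by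
  have h := AddChar.sum_mulShift a (ZMod.isPrimitive_stdAddChar d)
  simpa [ZMod.card] using h

/-! ### Tensor products -/

theorem tensor_mul [NeZero d] (p q : Fin n → Op1 d) :
    tensor p * tensor q = tensor fun k => p k * q k := by
  ext x y
  simp only [tensor, Matrix.mul_apply, Matrix.of_apply]
  simp only [← Finset.prod_mul_distrib]
  exact (Fintype.prod_sum fun k z => p k (x k) z * q k z (y k)).symm

theorem tensor_one : tensor (fun _ : Fin n => (1 : Op1 d)) = 1 := by
  ext x y
  simp only [tensor, Matrix.of_apply, Matrix.one_apply, Finset.prod_ite_zero, Finset.prod_const_one]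
  simp [funext_iff]

theorem tensor_star (p : Fin n → Op1 d) : star (tensor p) = tensor fun k => star (p k) := by
  ext x y
  simp [tensor, Matrix.star_apply]

theorem tensor_smul (c : Fin n → ℂ) (p : Fin n → Op1 d) :
    (tensor fun k => c k • p k) = (∏ k, c k) • tensor p := by
  ext x y
  simp [tensor, Finset.prod_mul_distrib]

theorem tensor_mem_unitaryGroup [NeZero d] {p : Fin n → Op1 d}
    (hp : ∀ k, p k ∈ Matrix.unitaryGroup (ZMod d) ℂ) :
    tensor p ∈ Matrix.unitaryGroup (Fin n → ZMod d) ℂ := by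
  rw [Matrix.mem_unitaryGroup_iff, tensor_star, tensor_mul, ← tensor_one]
  congr 1
  funext k
  exact Matrix.mem_unitaryGroup_iff.1 (hp k)

theorem onQudit_mul [NeZero d] (i : Fin n) (g h : Op1 d) :
    onQudit i g * onQudit i h = onQudit i (g * h) := by
  rw [onQudit, onQudit, onQudit, tensor_mul]
  congr 1
  funext k
  by_cases hk : k = i
  · subst hk; simp
  · simp [hk]

theorem onQudit_one (i : Fin n) : onQudit i (1 : Op1 d) = 1 := by
  rw [onQudit, Function.update_eq_self_iff.2 rfl, tensor_one]

theorem onQudit_mem_unitaryGroup [NeZero d] (i : Fin n) {g : Op1 d}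
    (hg : g ∈ Matrix.unitaryGroup (ZMod d) ℂ) :
    onQudit i g ∈ Matrix.unitaryGroup (Fin n → ZMod d) ℂ := by
  refine tensor_mem_unitaryGroup fun k => ?_
  by_cases hk : k = i
  · subst hk; simpa using hg
  · simp [hk, one_mem]

/-! ### Weyl operators -/

/-- The one-qudit Weyl operator `X ^ a Z ^ b`. -/
noncomputable def weylOne [NeZero d] (a b : ZMod d) : Op1 d :=
  Matrix.of fun x y => if x = y + a then chi d (b * y) else 0

/-- The phase space `(ℤ/d)ⁿ × (ℤ/d)ⁿ`. -/
abbrev Phase (d n : ℕ) : Type := (Fin n → ZMod d) × (Fin n → ZMod d)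

/-- The Weyl operator `X ^ v₁ Z ^ v₂` on `n` qudits. -/
noncomputable def weyl [NeZero d] (v : Phase d n) : Op d n :=
  tensor fun k => weylOne (v.1 k) (v.2 k)

theorem weylOne_mul [NeZero d] (a b a' b' : ZMod d) :
    weylOne a b * weylOne a' b' = chi d (b * a') • weylOne (a + a') (b + b') := by
  ext x y
  simp only [weylOne, Matrix.mul_apply, Matrix.of_apply, Matrix.smul_apply, mul_ite, mul_zero,
    Finset.sum_ite_eq', Finset.mem_univ, if_true, smul_eq_mul]
  rw [add_assoc, add_comm a' a]
  split_ifs with h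
  · rw [← AddChar.map_add_eq_mul, ← AddChar.map_add_eq_mul]
    congr 1; ring
  · simp

theorem weylOne_zero [NeZero d] : weylOne (0 : ZMod d) 0 = 1 := by
  ext x y
  simp [weylOne, Matrix.one_apply]

theorem weyl_apply [NeZero d] (v : Phase d n) (x y : Fin n → ZMod d) :
    weyl v x y = if x = y + v.1 then chi d (v.2 ⬝ᵥ y) else 0 := by
  simp only [weyl, tensor, weylOne, Matrix.of_apply, Finset.prod_ite_zero, Finset.mem_univ,
    true_implies, dotProduct, chi_sum, funext_iff, Pi.add_apply]

theorem weyl_mul [NeZero d] (v w : Phase d n) :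
    weyl v * weyl w = chi d (v.2 ⬝ᵥ w.1) • weyl (v + w) := by
  simp only [weyl, tensor_mul, weylOne_mul, tensor_smul, dotProduct, chi_sum,
    Prod.fst_add, Prod.snd_add, Pi.add_apply]

theorem weyl_zero [NeZero d] : weyl (0 : Phase d n) = 1 := by
  simp [weyl, weylOne_zero, tensor_one]

theorem weyl_mul_weyl_neg [NeZero d] (v : Phase d n) :
    weyl v * weyl (-v) = chi d (-(v.2 ⬝ᵥ v.1)) • 1 := by
  rw [weyl_mul, add_neg_cancel, weyl_zero]
  simp

theorem weyl_ne_zero [NeZero d] (v : Phase d n) : weyl v ≠ 0 := by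
  intro h
  have := weyl_mul_weyl_neg v
  rw [h, zero_mul] at this
  have := congrFun (congrFun this 0) 0
  exact chi_ne_zero (-(v.2 ⬝ᵥ v.1)) (by simpa using this.symm)

/-- Column 0 is supported at the shift part, which is thereby determined. The remaining entries
compare two characters; at 0 they force c = 1, and at unit vectors they give the Z part. -/
theorem smul_weyl_injective [NeZero d] {v w : Phase d n} {c : ℂ} (h : weyl v = c • weyl w) :
    v = w := by
  have hentry : ∀ x y, weyl v x y = c * weyl w x y := fun x y => by rw [h]; rfl
  have hc : c ≠ 0 := by
    rintro rfl
    exact weyl_ne_zero v (by simpa using h)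
  have h1 : v.1 = w.1 := by
    have := hentry v.1 0
    by_contra hne
    simp [weyl_apply, hne] at this
  have hb : ∀ y, chi d (v.2 ⬝ᵥ y) = c * chi d (w.2 ⬝ᵥ y) := fun y => by
    have := hentry (y + v.1) y
    simpa [weyl_apply, h1] using this
  have hc1 : c = 1 := by simpa using (hb 0).symm
  refine Prod.ext h1 (funext fun k => ?_)
  have := hb (Pi.single k 1)
  rw [hc1, one_mul] at this
  simpa using ZMod.injective_stdAddChar this

/-! ### Conjugation relations -/

/-- `U` conjugates the Weyl operator of `v` into a multiple of the Weyl operator of `w`. -/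
def Maps [NeZero d] (U : Op d n) (v w : Phase d n) : Prop :=
  ∃ c : ℂ, U * weyl v = c • (weyl w * U)

theorem Maps.mul [NeZero d] {U U' : Op d n} {u v w : Phase d n} (h : Maps U v w)
    (h' : Maps U' u v) : Maps (U * U') u w := by
  obtain ⟨c, hc⟩ := h
  obtain ⟨c', hc'⟩ := h'
  refine ⟨c' * c, ?_⟩
  rw [mul_assoc, hc', mul_smul_comm, ← mul_assoc, hc, smul_mul_assoc, smul_smul, mul_assoc]

theorem Maps.add [NeZero d] {U : Op d n} {v w v' w' : Phase d n} (h : Maps U v w)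
    (h' : Maps U v' w') : Maps U (v + v') (w + w') := by
  obtain ⟨c, hc⟩ := h
  obtain ⟨c', hc'⟩ := h'
  have e : weyl (v + v') = (chi d (v.2 ⬝ᵥ v'.1))⁻¹ • (weyl v * weyl v') := by
    rw [weyl_mul, smul_smul, inv_mul_cancel₀ (chi_ne_zero _), one_smul]
  have key : weyl w * U * weyl v' = (c' * chi d (w.2 ⬝ᵥ w'.1)) • (weyl (w + w') * U) := by
    rw [mul_assoc, hc', mul_smul_comm, ← mul_assoc, weyl_mul, smul_mul_assoc, smul_smul]
  refine ⟨(chi d (v.2 ⬝ᵥ v'.1))⁻¹ * (c * (c' * chi d (w.2 ⬝ᵥ w'.1))), ?_⟩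
  rw [e, mul_smul_comm, ← mul_assoc, hc, smul_mul_assoc, key, smul_smul, smul_smul, mul_assoc]

theorem Maps.zero [NeZero d] (U : Op d n) : Maps U 0 0 := ⟨1, by simp [weyl_zero]⟩

theorem Maps.smul [NeZero d] {U : Op d n} {v w : Phase d n} (h : Maps U v w) (t : ZMod d) :
    Maps U (t • v) (t • w) := by
  have hn : ∀ k : ℕ, Maps U (k • v) (k • w) := fun k => by
    induction k with
    | zero => simpa using Maps.zero U
    | succ k ih => simpa only [succ_nsmul] using ih.add h
  have ht : ∀ u : Phase d n, t • u = t.val • u := fun u => by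
    rw [← Nat.cast_smul_eq_nsmul (ZMod d), ZMod.natCast_zmod_val]
  rw [ht, ht]
  exact hn _

theorem Maps.one [NeZero d] (v : Phase d n) : Maps 1 v v := ⟨1, by simp⟩

/-- The symplectic form on phase space. -/
def symp (v w : Phase d n) : ZMod d := v.1 ⬝ᵥ w.2 - v.2 ⬝ᵥ w.1

theorem weyl_comm [NeZero d] (v w : Phase d n) :
    weyl v * weyl w = chi d (-symp v w) • (weyl w * weyl v) := by
  rw [weyl_mul, weyl_mul, smul_smul, ← AddChar.map_add_eq_mul, add_comm w v]
  congr 2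
  rw [symp, dotProduct_comm w.2]
  ring

theorem Maps.conj [NeZero d] {U : Op d n} (hU : U ∈ Matrix.unitaryGroup (Fin n → ZMod d) ℂ)
    {v w : Phase d n} (h : Maps U v w) : ∃ c : ℂ, c ≠ 0 ∧ U * weyl v * star U = c • weyl w := by
  obtain ⟨c, hc⟩ := h
  refine ⟨c, ?_, ?_⟩
  · rintro rfl
    have h0 : star U * (U * weyl v) = 0 := by rw [hc]; simp
    rw [← mul_assoc, Matrix.mem_unitaryGroup_iff'.1 hU, one_mul] at h0
    exact weyl_ne_zero v h0
  · rw [hc, smul_mul_assoc, mul_assoc, Matrix.mem_unitaryGroup_iff.1 hU, mul_one]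

/-- Conjugation by U preserves the scalar by which two Weyl operators commute, and the standard
character is injective, so the exponent is preserved too. -/
theorem Maps.symp_eq [NeZero d] {U : Op d n}
    (hU : U ∈ Matrix.unitaryGroup (Fin n → ZMod d) ℂ)
    {v w v' w' : Phase d n} (h : Maps U v w) (h' : Maps U v' w') : symp v v' = symp w w' := by
  obtain ⟨c, hc, e⟩ := h.conj hU
  obtain ⟨c', hc', e'⟩ := h'.conj hU
  have hmul : ∀ A B : Op d n, (U * A * star U) * (U * B * star U) = U * (A * B) * star U := by
    intro A B
    calc _ = U * A * (star U * U) * B * star U := by simp only [mul_assoc]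
      _ = _ := by rw [Matrix.mem_unitaryGroup_iff'.1 hU, mul_one]; simp only [mul_assoc]
  have h1 := hmul (weyl v) (weyl v')
  have h2 := hmul (weyl v') (weyl v)
  rw [weyl_comm v v', mul_smul_comm, smul_mul_assoc, ← h2, e, e'] at h1
  simp only [smul_mul_assoc, mul_smul_comm, smul_smul] at h1
  rw [weyl_comm w w', weyl_mul w' w, smul_smul, smul_smul, smul_smul] at h1
  have h3 := smul_left_injective ℂ (weyl_ne_zero (w' + w)) h1
  have h4 : chi d (-symp w w') = chi d (-symp v v') := by
    have := chi_ne_zero (d := d) (w'.2 ⬝ᵥ w.1)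
    have hne : c * c' * chi d (w'.2 ⬝ᵥ w.1) ≠ 0 := by positivity
    apply mul_left_cancel₀ hne
    linear_combination h3
  exact neg_injective (ZMod.injective_stdAddChar h4.symm)

theorem Maps.eq_of_eq [NeZero d] {U : Op d n}
    (hU : U ∈ Matrix.unitaryGroup (Fin n → ZMod d) ℂ)
    {v v' w : Phase d n} (h : Maps U v w) (h' : Maps U v' w) : v = v' := by
  obtain ⟨c, hc, e⟩ := h.conj hU
  obtain ⟨c', hc', e'⟩ := h'.conj hU
  have hback : ∀ A : Op d n, star U * (U * A * star U) * U = A := by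
    intro A
    calc _ = (star U * U) * A * (star U * U) := by simp only [mul_assoc]
      _ = _ := by rw [Matrix.mem_unitaryGroup_iff'.1 hU, mul_one, one_mul]
  refine smul_weyl_injective (c := c * c'⁻¹) ?_
  rw [← hback (weyl v), ← hback (weyl v'), e, e']
  simp [smul_smul, hc']

end Operators

/-! ### Action of the gates on phase space, and Weyl operators as circuits -/

section Gates

variable {d n : ℕ}

/-! ### The one-qudit gates -/

theorem matF_apply [NeZero d] (x y : ZMod d) :
    matF d x y = ((Real.sqrt d : ℝ) : ℂ)⁻¹ * chi d (x * y) := by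
  rw [matF, Matrix.of_apply, omega_pow, Nat.cast_mul, ZMod.natCast_zmod_val,
    ZMod.natCast_zmod_val, mul_comm y]

theorem inv_sqrt_mul_self [NeZero d] :
    ((Real.sqrt d : ℝ) : ℂ)⁻¹ * ((Real.sqrt d : ℝ) : ℂ)⁻¹ * d = 1 := by
  have h : ((Real.sqrt d : ℝ) : ℂ) * ((Real.sqrt d : ℝ) : ℂ) = d := by
    rw [← Complex.ofReal_mul, Real.mul_self_sqrt (Nat.cast_nonneg d), Complex.ofReal_natCast]
  rw [← mul_inv, h, inv_mul_cancel₀ (Nat.cast_ne_zero.2 (NeZero.ne d))]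

theorem star_matF_mul_matF [NeZero d] : star (matF d) * matF d = 1 := by
  ext x y
  have h : ∀ z, star (matF d) x z * matF d z y =
      ((Real.sqrt d : ℝ) : ℂ)⁻¹ * ((Real.sqrt d : ℝ) : ℂ)⁻¹ * chi d (z * (y - x)) := by
    intro z
    have hs : star (((Real.sqrt d : ℝ) : ℂ)⁻¹) = ((Real.sqrt d : ℝ) : ℂ)⁻¹ := by
      rw [star_inv₀]
      congr 1
      exact Complex.conj_ofReal _
    rw [Matrix.star_apply, matF_apply, matF_apply, star_mul', star_chi, hs, mul_sub, sub_eq_neg_add,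
      AddChar.map_add_eq_mul]
    ring
  rw [Matrix.mul_apply, Finset.sum_congr rfl fun z _ => h z, ← Finset.mul_sum, sum_chi_mul,
    Matrix.one_apply]
  by_cases hxy : x = y
  · simp [hxy, inv_sqrt_mul_self]
  · simp [hxy, sub_eq_zero, Ne.symm hxy]

theorem matF_mem [NeZero d] : matF d ∈ Matrix.unitaryGroup (ZMod d) ℂ :=
  Matrix.mem_unitaryGroup_iff'.2 star_matF_mul_matF

theorem matF_sq_apply [NeZero d] (x y : ZMod d) :
    (matF d ^ 2) x y = if x = -y then 1 else 0 := by
  have h : ∀ z, matF d x z * matF d z y =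
      ((Real.sqrt d : ℝ) : ℂ)⁻¹ * ((Real.sqrt d : ℝ) : ℂ)⁻¹ * chi d (z * (x + y)) := by
    intro z
    rw [matF_apply, matF_apply, mul_add, AddChar.map_add_eq_mul, mul_comm x z]
    ring
  rw [pow_two, Matrix.mul_apply, Finset.sum_congr rfl fun z _ => h z, ← Finset.mul_sum, sum_chi_mul]
  by_cases hxy : x = -y
  · simp [hxy, inv_sqrt_mul_self]
  · simp [hxy, ← eq_neg_iff_add_eq_zero]

theorem matF_sq_mul_apply [NeZero d] (A : Op1 d) (x y : ZMod d) :
    (matF d ^ 2 * A) x y = A (-x) y := by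
  simp only [Matrix.mul_apply, matF_sq_apply, eq_neg_iff_add_eq_zero, ite_mul, one_mul, zero_mul]
  simp only [← neg_eq_iff_add_eq_zero, Finset.sum_ite_eq, Finset.mem_univ, if_true]

theorem matF_pow_four [NeZero d] : matF d ^ 4 = 1 := by
  ext x y
  rw [show 4 = 2 + 2 from rfl, pow_add, matF_sq_mul_apply, matF_sq_apply, Matrix.one_apply]
  simp

theorem matF_mul_weylOne [NeZero d] (a b : ZMod d) :
    matF d * weylOne a b = chi d (-(a * b)) • (weylOne (-b) a * matF d) := by
  ext x y
  have h : ∀ z, (x = z + -b) ↔ (x + b = z) := fun z => by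
    rw [← sub_eq_add_neg, eq_sub_iff_add_eq]
  simp only [weylOne, Matrix.mul_apply, Matrix.of_apply, Matrix.smul_apply, mul_ite, mul_zero,
    ite_mul, zero_mul, Finset.sum_ite_eq', Finset.sum_ite_eq, Finset.mem_univ, if_true,
    smul_eq_mul, matF_apply, h]
  have e : chi d (x * (y + a)) * chi d (b * y) =
      chi d (-(a * b)) * (chi d (a * (x + b)) * chi d ((x + b) * y)) := by
    simp only [← AddChar.map_add_eq_mul]
    congr 1; ring
  linear_combination ((Real.sqrt d : ℝ) : ℂ)⁻¹ * e

theorem two_ne_zero_of_odd [Fact d.Prime] (hd : Odd d) : (2 : ZMod d) ≠ 0 := by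
  intro h
  have h2 : ((2 : ℕ) : ZMod d) = 0 := by exact_mod_cast h
  rw [ZMod.natCast_eq_zero_iff] at h2
  have := (Nat.prime_dvd_prime_iff_eq Fact.out Nat.prime_two).1 h2
  rw [this] at hd
  exact absurd hd (by decide)

/-- Since j(j + 1) is even and 2 is invertible mod d, the exact natural-number quotient casts to the
quotient in the field. -/
theorem matS_eq [Fact d.Prime] (hd : Odd d) :
    matS d = Matrix.diagonal fun j => chi d (j * (j + 1) / 2) := by
  rw [matS]
  congr 1
  funext j
  have h2 : ((2 : ℕ) : ZMod d) ≠ 0 := by exact_mod_cast two_ne_zero_of_odd hd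
  rw [omega_pow, Nat.cast_div (Nat.even_mul_succ_self _).two_dvd h2]
  congr 1
  push_cast
  rw [ZMod.natCast_zmod_val]

theorem matS_mem [Fact d.Prime] (hd : Odd d) : matS d ∈ Matrix.unitaryGroup (ZMod d) ℂ := by
  rw [Matrix.mem_unitaryGroup_iff', matS_eq hd, Matrix.star_eq_conjTranspose,
    Matrix.diagonal_conjTranspose, Matrix.diagonal_mul_diagonal, ← Matrix.diagonal_one]
  congr 1
  funext j
  rw [Pi.star_apply, star_chi, ← AddChar.map_add_eq_mul]
  simp

theorem matS_mul_weylOne [Fact d.Prime] (hd : Odd d) (a b : ZMod d) :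
    matS d * weylOne a b = chi d (a * (a + 1) / 2) • (weylOne a (b + a) * matS d) := by
  have h2 := two_ne_zero_of_odd hd
  ext x y
  simp only [matS_eq hd, Matrix.diagonal_mul, Matrix.smul_apply, Matrix.mul_diagonal, weylOne,
    Matrix.of_apply, smul_eq_mul]
  split_ifs with h
  · subst h
    simp only [← AddChar.map_add_eq_mul]
    congr 1
    field_simp
    ring
  · simp

theorem weylOne_zero_left [NeZero d] (b : ZMod d) :
    weylOne 0 b = Matrix.diagonal fun j => chi d (b * j) := by
  ext x y
  by_cases h : x = y
  · simp [weylOne, h]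
  · simp [weylOne, h]

theorem weylOne_zero_left_pow [NeZero d] (b : ZMod d) (k : ℕ) :
    weylOne 0 b ^ k = weylOne 0 ((k : ZMod d) * b) := by
  induction k with
  | zero => simp [weylOne_zero]
  | succ k ih =>
    rw [pow_succ, ih, weylOne_mul]
    simp [add_mul]

theorem weylOne_zero_right_pow [NeZero d] (a : ZMod d) (k : ℕ) :
    weylOne a 0 ^ k = weylOne ((k : ZMod d) * a) 0 := by
  induction k with
  | zero => simp [weylOne_zero]
  | succ k ih =>
    rw [pow_succ, ih, weylOne_mul]
    simp [add_mul]

/-- F² is the parity j ↦ -j, so F²SF² has phases j(j - 1)/2. Its (d - 1)-th power is its inverse,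
and j(j + 1)/2 - j(j - 1)/2 = j. This writes Z without inverse gates. -/
theorem weylOne_zero_one_eq [Fact d.Prime] (hd : Odd d) :
    weylOne 0 1 = matS d * (matF d ^ 2 * (matS d * matF d ^ 2)) ^ (d - 1) := by
  have h2 := two_ne_zero_of_odd hd
  have h : matF d ^ 2 * (matS d * matF d ^ 2) =
      Matrix.diagonal fun j => chi d (j * (j - 1) / 2) := by
    ext x y
    rw [matF_sq_mul_apply, matS_eq hd, Matrix.diagonal_mul, matF_sq_apply, Matrix.diagonal_apply]
    simp only [neg_inj, mul_ite, mul_one, mul_zero]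
    congr 2
    ring
  rw [h, weylOne_zero_left, Matrix.diagonal_pow, matS_eq hd, Matrix.diagonal_mul_diagonal]
  congr 1
  funext j
  have hd1 : ((d - 1 : ℕ) : ZMod d) = -1 := by
    rw [Nat.cast_sub (Fact.out : d.Prime).one_le]
    simp
  rw [Pi.pow_apply, ← AddChar.map_nsmul_eq_pow, ← AddChar.map_add_eq_mul, nsmul_eq_mul, hd1]
  congr 1
  field_simp
  ring

theorem weylOne_mem_closure [Fact d.Prime] (hd : Odd d) (a b : ZMod d) :
    weylOne a b ∈ Submonoid.closure {matF d, matS d} := by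
  have hF : matF d ∈ Submonoid.closure {matF d, matS d} := Submonoid.subset_closure (by simp)
  have hS : matS d ∈ Submonoid.closure {matF d, matS d} := Submonoid.subset_closure (by simp)
  have hZ : ∀ b, weylOne 0 b ∈ Submonoid.closure {matF d, matS d} := fun b => by
    have h1 : weylOne 0 1 ∈ Submonoid.closure {matF d, matS d} := by
      rw [weylOne_zero_one_eq hd]
      exact mul_mem hS (pow_mem (mul_mem (pow_mem hF 2) (mul_mem hS (pow_mem hF 2))) _)
    have h := pow_mem h1 b.val
    rwa [weylOne_zero_left_pow, ZMod.natCast_zmod_val, mul_one] at h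
  have hX : weylOne a 0 ∈ Submonoid.closure {matF d, matS d} := by
    -- F turns Z^(-a) into X^a under conjugation, and F³ = F⁻¹.
    have h : weylOne a 0 = matF d * weylOne 0 (-a) * matF d ^ 3 := by
      rw [matF_mul_weylOne, smul_mul_assoc, mul_assoc, ← pow_succ', matF_pow_four]
      simp
    rw [h]
    exact mul_mem (mul_mem hF (hZ _)) (pow_mem hF 3)
  have h : weylOne a b = weylOne a 0 * weylOne 0 b := by rw [weylOne_mul]; simp
  rw [h]
  exact mul_mem hX (hZ b)

/-! ### The controlled shift -/

theorem onPair_matCX_apply [NeZero d] {i j : Fin n} (hij : i ≠ j) (x y : Fin n → ZMod d) :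
    onPair i j (matCX d) x y = if x = y + Pi.single j (y i) then 1 else 0 := by
  have h : (x = y + Pi.single j (y i)) ↔
      (∀ k, k ≠ i → k ≠ j → x k = y k) ∧ (x i, x j) = (y i, y i + y j) := by
    rw [Prod.mk.injEq]
    constructor
    · rintro rfl
      refine ⟨fun k _ hk => by simp [hk], by simp [hij], by simp [add_comm]⟩
    · rintro ⟨h1, h2, h3⟩
      funext k
      by_cases hkj : k = j
      · subst hkj; simp [h3, add_comm]
      · by_cases hki : k = i
        · subst hki; simp [h2, hkj]
        · simp [h1 k hki hkj, hkj]
  simp only [onPair, Matrix.of_apply, matCX, h, ite_and]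

theorem onPair_matCX_mem [NeZero d] {i j : Fin n} (hij : i ≠ j) :
    onPair i j (matCX d) ∈ Matrix.unitaryGroup (Fin n → ZMod d) ℂ := by
  rw [Matrix.mem_unitaryGroup_iff']
  ext x y
  have h : (y + Pi.single j (y i) = x + Pi.single j (x i)) ↔ x = y := by
    refine ⟨fun h => ?_, fun h => by rw [h]⟩
    have hi : y i = x i := by simpa [hij] using congrFun h i
    rw [hi] at h
    exact (add_right_cancel h).symm
  simp only [Matrix.mul_apply, Matrix.star_apply, onPair_matCX_apply hij, apply_ite star, star_one,
    star_zero, mul_ite, mul_one, mul_zero, Finset.sum_ite_eq', Finset.mem_univ, if_true,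
    Matrix.one_apply, h]

theorem maps_onPair_matCX [NeZero d] {i j : Fin n} (hij : i ≠ j) (v : Phase d n) :
    Maps (onPair i j (matCX d)) v
      (v.1 + Pi.single j (v.1 i), v.2 - Pi.single i (v.2 j)) := by
  refine ⟨1, ?_⟩
  ext x y
  have hadd : y + v.1 + Pi.single j ((y + v.1) i) =
      y + Pi.single j (y i) + (v.1 + Pi.single j (v.1 i)) := by
    rw [Pi.add_apply, Pi.single_add]
    abel
  have hdot : (v.2 - Pi.single i (v.2 j)) ⬝ᵥ (y + Pi.single j (y i)) = v.2 ⬝ᵥ y := by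
    simp [sub_dotProduct, dotProduct_add, hij]
  simp only [Matrix.mul_apply, one_smul, onPair_matCX_apply hij, weyl_apply, mul_ite, mul_zero,
    mul_one, Finset.sum_ite_eq', Finset.mem_univ, if_true, hdot, ← hadd, ite_mul, one_mul,
    zero_mul]

/-! ### Gates acting on one qudit -/

theorem maps_onQudit [NeZero d] (i : Fin n) {g : Op1 d} {v : Phase d n} {a b : ZMod d} {c : ℂ}
    (h : g * weylOne (v.1 i) (v.2 i) = c • (weylOne a b * g)) :
    Maps (onQudit i g) v (Function.update v.1 i a, Function.update v.2 i b) := by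
  refine ⟨∏ k, Function.update (fun _ : Fin n => (1 : ℂ)) i c k, ?_⟩
  rw [onQudit, weyl, weyl, tensor_mul, tensor_mul, ← tensor_smul]
  congr 1
  funext k
  by_cases hk : k = i
  · subst hk; simpa using h
  · simp [hk]

theorem maps_onQudit_matF [NeZero d] (i : Fin n) (v : Phase d n) :
    Maps (onQudit i (matF d)) v
      (Function.update v.1 i (-v.2 i), Function.update v.2 i (v.1 i)) :=
  maps_onQudit i (matF_mul_weylOne _ _)

theorem maps_onQudit_matS [Fact d.Prime] (hd : Odd d) (i : Fin n) (v : Phase d n) :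
    Maps (onQudit i (matS d)) v (v.1, v.2 + Pi.single i (v.1 i)) := by
  have h := maps_onQudit i (matS_mul_weylOne hd (v.1 i) (v.2 i))
  rw [Function.update_eq_self] at h
  convert h using 2
  funext k
  by_cases hk : k = i
  · subst hk; simp
  · simp [hk]

theorem onQudit_mem_circuits [NeZero d] {E : Fin n → Fin n → Prop} (i : Fin n) {g : Op1 d}
    (hg : g ∈ Submonoid.closure {matF d, matS d}) : onQudit i g ∈ circuits d n E := by
  induction hg using Submonoid.closure_induction with
  | mem g hg =>
    rcases hg with rfl | rfl
    · exact Submonoid.subset_closure (Or.inl ⟨i, rfl⟩)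
    · exact Submonoid.subset_closure (Or.inr (Or.inl ⟨i, rfl⟩))
  | one => rw [onQudit_one]; exact one_mem _
  | mul g h _ _ ihg ihh => rw [← onQudit_mul]; exact mul_mem ihg ihh

theorem tensor_mem_circuits [NeZero d] {E : Fin n → Fin n → Prop} {p : Fin n → Op1 d}
    (hp : ∀ i, p i ∈ Submonoid.closure {matF d, matS d}) : tensor p ∈ circuits d n E := by
  have key : ∀ s : Finset (Fin n), tensor (s.piecewise p fun _ => 1) ∈ circuits d n E := by
    intro s
    induction s using Finset.induction_on with
    | empty => rw [Finset.piecewise_empty, tensor_one]; exact one_mem _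
    | insert i s hi ih =>
      have h : tensor ((insert i s).piecewise p fun _ => 1) =
          onQudit i (p i) * tensor (s.piecewise p fun _ => 1) := by
        rw [onQudit, tensor_mul]
        congr 1
        funext k
        by_cases hk : k = i
        · subst hk; simp [hi]
        · by_cases hks : k ∈ s <;> simp [hk, hks]
      rw [h]
      exact mul_mem (onQudit_mem_circuits i (hp i)) ih
  simpa using key Finset.univ

theorem weyl_mem_circuits [Fact d.Prime] (hd : Odd d) {E : Fin n → Fin n → Prop}
    (v : Phase d n) : weyl v ∈ circuits d n E :=
  tensor_mem_circuits fun _ => weylOne_mem_closure hd _ _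

end Gates

/-! ### The Clifford group in terms of Weyl operators -/

section Pauli

variable {d n : ℕ} [NeZero d]

theorem matX_eq : matX d = weylOne 1 0 := by
  ext x y
  simp [matX, weylOne]

theorem matZ_eq : matZ d = weylOne 0 1 := by
  rw [matZ, weylOne_zero_left]
  simp only [omega_pow_val, one_mul]

theorem star_weylOne (a b : ZMod d) :
    star (weylOne a b) = chi d (a * b) • weylOne (-a) (-b) := by
  ext x y
  have h : (y = x + a) ↔ (x = y + -a) := by rw [← sub_eq_add_neg, eq_sub_iff_add_eq, eq_comm]
  simp only [Matrix.star_apply, weylOne, Matrix.of_apply, Matrix.smul_apply, h, smul_eq_mul]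
  split_ifs with hx
  · rw [star_chi, ← AddChar.map_add_eq_mul]
    congr 1
    rw [hx]; ring
  · simp

theorem weylOne_mem_unitaryGroup (a b : ZMod d) :
    weylOne a b ∈ Matrix.unitaryGroup (ZMod d) ℂ := by
  rw [Matrix.mem_unitaryGroup_iff, star_weylOne, mul_smul_comm, weylOne_mul, smul_smul,
    ← AddChar.map_add_eq_mul]
  simp [weylOne_zero, mul_comm a b]

theorem weyl_mem_unitaryGroup (v : Phase d n) :
    weyl v ∈ Matrix.unitaryGroup (Fin n → ZMod d) ℂ :=
  tensor_mem_unitaryGroup fun _ => weylOne_mem_unitaryGroup _ _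

theorem exists_eq_smul_weylOne {p : Matrix.unitaryGroup (ZMod d) ℂ} (hp : p ∈ pauliOne d) :
    ∃ (c : ℂ) (a b : ZMod d), (p : Op1 d) = c • weylOne a b := by
  induction hp using Subgroup.closure_induction with
  | mem p hp =>
    rcases hp with rfl | rfl
    · exact ⟨1, 1, 0, by rw [one_smul]; exact matX_eq⟩
    · exact ⟨1, 0, 1, by rw [one_smul]; exact matZ_eq⟩
  | one => exact ⟨1, 0, 0, by rw [weylOne_zero, one_smul]; rfl⟩
  | mul p q _ _ hp hq =>
    obtain ⟨c, a, b, h⟩ := hp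
    obtain ⟨c', a', b', h'⟩ := hq
    refine ⟨c' * c * chi d (b * a'), a + a', b + b', ?_⟩
    rw [Submonoid.coe_mul, h, h', smul_mul_assoc, mul_smul_comm, weylOne_mul]
    simp only [smul_smul]
    congr 1; ring
  | inv p _ hp =>
    obtain ⟨c, a, b, h⟩ := hp
    refine ⟨star c * chi d (a * b), -a, -b, ?_⟩
    have hs : ((p⁻¹ : Matrix.unitaryGroup (ZMod d) ℂ) : Op1 d) = star (p : Op1 d) := rfl
    rw [hs, h, star_smul, star_weylOne, smul_smul]

theorem weylOne_mem_pauliOne (a b : ZMod d) :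
    (⟨weylOne a b, weylOne_mem_unitaryGroup a b⟩ : Matrix.unitaryGroup (ZMod d) ℂ) ∈
      pauliOne d := by
  have h : (⟨weylOne a b, weylOne_mem_unitaryGroup a b⟩ : Matrix.unitaryGroup (ZMod d) ℂ) =
      ⟨matX d, matX_mem d⟩ ^ a.val * ⟨matZ d, matZ_mem d⟩ ^ b.val := by
    apply Subtype.ext
    simp only [Submonoid.coe_mul, SubmonoidClass.coe_pow, matX_eq, matZ_eq]
    rw [weylOne_zero_left_pow, weylOne_zero_right_pow, weylOne_mul]
    simp
  rw [h]
  exact mul_mem (pow_mem (Subgroup.subset_closure (by simp)) _)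
    (pow_mem (Subgroup.subset_closure (by simp)) _)

theorem weyl_mem_pauli (v : Phase d n) : weyl v ∈ pauli d n :=
  ⟨fun k => ⟨weylOne (v.1 k) (v.2 k), weylOne_mem_unitaryGroup _ _⟩,
    fun _ => weylOne_mem_pauliOne _ _, rfl⟩

theorem exists_eq_smul_weyl {A : Op d n} (hA : A ∈ pauli d n) :
    ∃ (c : ℂ) (v : Phase d n), A = c • weyl v := by
  obtain ⟨p, hp, rfl⟩ := hA
  choose c a b h using fun k => exists_eq_smul_weylOne (hp k)
  exact ⟨∏ k, c k, (a, b), by simp only [h, tensor_smul]; rfl⟩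

/-- Pauli and Weyl operators agree up to scalars, and the definition of the Clifford group ignores
scalars. -/
theorem mem_clifford_iff {U : Op d n} :
    U ∈ clifford d n ↔
      U ∈ Matrix.unitaryGroup (Fin n → ZMod d) ℂ ∧ ∀ v, ∃ w, Maps U v w := by
  refine and_congr_right fun hU => ⟨fun h v => ?_, fun h A hA => ?_⟩
  · obtain ⟨A', hA', c, hc⟩ := h _ (weyl_mem_pauli v)
    obtain ⟨c', w, rfl⟩ := exists_eq_smul_weyl hA'
    refine ⟨w, c * c', ?_⟩
    rw [← smul_mul_assoc, ← smul_smul, ← hc, mul_assoc, ← Matrix.star_eq_conjTranspose,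
      Matrix.mem_unitaryGroup_iff'.1 hU, mul_one]
  · obtain ⟨c, v, rfl⟩ := exists_eq_smul_weyl hA
    obtain ⟨w, hw⟩ := h v
    obtain ⟨c', -, hc'⟩ := hw.conj hU
    refine ⟨weyl w, weyl_mem_pauli w, c * c', ?_⟩
    rw [mul_smul_comm, smul_mul_assoc, ← Matrix.star_eq_conjTranspose, hc', smul_smul]

theorem circuits_subset_clifford [Fact d.Prime] (hd : Odd d) {E : Fin n → Fin n → Prop}
    {U : Op d n} (hU : U ∈ circuits d n E) : U ∈ clifford d n := by
  rw [mem_clifford_iff]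
  induction hU using Submonoid.closure_induction with
  | mem U hU =>
    rcases hU with ⟨i, rfl⟩ | ⟨i, rfl⟩ | ⟨i, j, hij, -, rfl⟩
    · exact ⟨onQudit_mem_unitaryGroup i matF_mem, fun v => ⟨_, maps_onQudit_matF i v⟩⟩
    · exact ⟨onQudit_mem_unitaryGroup i (matS_mem hd), fun v => ⟨_, maps_onQudit_matS hd i v⟩⟩
    · exact ⟨onPair_matCX_mem hij, fun v => ⟨_, maps_onPair_matCX hij v⟩⟩
  | one => exact ⟨one_mem _, fun v => ⟨v, Maps.one v⟩⟩
  | mul U U' _ _ h h' =>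
    refine ⟨mul_mem h.1 h'.1, fun v => ?_⟩
    obtain ⟨w, hw⟩ := h'.2 v
    obtain ⟨u, hu⟩ := h.2 w
    exact ⟨u, hu.mul hw⟩

theorem norm_eq_one_of_smul_mem {c : ℂ} {U : Op d n}
    (hU : U ∈ Matrix.unitaryGroup (Fin n → ZMod d) ℂ)
    (h : c • U ∈ Matrix.unitaryGroup (Fin n → ZMod d) ℂ) : ‖c‖ = 1 := by
  rw [Matrix.mem_unitaryGroup_iff'] at h hU
  rw [star_smul, smul_mul_assoc, mul_smul_comm, hU, smul_smul] at h
  have h1 := congrFun (congrFun h 0) 0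
  have h2 : (starRingEnd ℂ) c * c = 1 := by simpa using h1
  rw [Complex.conj_mul'] at h2
  have h3 : ‖c‖ ^ 2 = 1 := by exact_mod_cast h2
  exact (pow_eq_one_iff_of_nonneg (norm_nonneg c) two_ne_zero).1 h3

theorem circuitsUpToPhase_subset_clifford [Fact d.Prime] (hd : Odd d)
    (E : Fin n → Fin n → Prop) : circuitsUpToPhase d n E ⊆ clifford d n := by
  rintro U ⟨c, hc, C, hC, rfl⟩
  obtain ⟨hCu, h⟩ := mem_clifford_iff.1 (circuits_subset_clifford hd hC)
  refine mem_clifford_iff.2 ⟨?_, fun v => ?_⟩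
  · rw [Matrix.mem_unitaryGroup_iff', star_smul, smul_mul_assoc, mul_smul_comm, smul_smul,
      Matrix.mem_unitaryGroup_iff'.1 hCu, Complex.star_def, Complex.conj_mul', hc]
    simp
  · obtain ⟨w, c', hw⟩ := h v
    exact ⟨w, c', by rw [smul_mul_assoc, hw, mul_smul_comm, smul_comm]⟩

/-- A unitary that commutes up to phases with all Weyl operators is itself a multiple of a
Weyl operator. -/
theorem exists_eq_smul_weyl_of_maps_self {U : Op d n}
    (hU : U ∈ Matrix.unitaryGroup (Fin n → ZMod d) ℂ) (h : ∀ v, Maps U v v) :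
    ∃ (c : ℂ) (v : Phase d n), U = c • weyl v := by
  have hU0 : U ≠ 0 := by
    rintro rfl
    have := Matrix.mem_unitaryGroup_iff.1 hU
    simp at this
  obtain ⟨x₀, y₀, h0⟩ : ∃ x y, U x y ≠ 0 := by
    by_contra! hc
    exact hU0 (by ext x y; simp [hc])
  choose f hf using h
  have hZ : ∀ b x y, U x y * chi d (b ⬝ᵥ y) = f (0, b) * (chi d (b ⬝ᵥ x) * U x y) := by
    intro b x y
    have h1 := congrFun (congrFun (hf (0, b)) x) y
    simpa [Matrix.mul_apply, weyl_apply] using h1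
  have hX : ∀ a x y, U (x + a) (y + a) = f (a, 0) * U x y := by
    intro a x y
    have h1 := congrFun (congrFun (hf (a, 0)) (x + a)) y
    simpa [Matrix.mul_apply, weyl_apply] using h1
  set t := x₀ - y₀ with ht
  -- At a nonzero entry, `hZ` determines the character b ↦ χ(b·(y - x)) as f(0, b), independently of
  -- the entry; so y - x is constant on the support.
  have hsupp : ∀ x y, U x y ≠ 0 → x = y + t := by
    intro x y hxy
    have hb : ∀ b, chi d (b ⬝ᵥ (y - x)) = f (0, b) := fun b => by
      have h1 := hZ b x y
      rw [dotProduct_sub, AddChar.map_sub_eq_div, div_eq_iff (chi_ne_zero _)]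
      apply mul_left_cancel₀ hxy
      linear_combination h1
    have hb0 : ∀ b, chi d (b ⬝ᵥ (y₀ - x₀)) = f (0, b) := fun b => by
      have h1 := hZ b x₀ y₀
      rw [dotProduct_sub, AddChar.map_sub_eq_div, div_eq_iff (chi_ne_zero _)]
      apply mul_left_cancel₀ h0
      linear_combination h1
    have h2 : y - x = y₀ - x₀ := by
      funext k
      have := ZMod.injective_stdAddChar ((hb (Pi.single k 1)).trans (hb0 (Pi.single k 1)).symm)
      simpa using this
    rw [ht, ← neg_sub y₀ x₀, ← h2]
    abel
  have hm : ∀ a, U (a + t) a = f (a, 0) * U t 0 := fun a => by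
    have := hX a t 0
    rwa [zero_add, add_comm t a] at this
  have hm0 : U t 0 ≠ 0 := by
    intro hz
    have h1 := hm y₀
    rw [hz, mul_zero, ← hsupp x₀ y₀ h0] at h1
    exact h0 h1
  have hf0 : f (0, 0) = 1 := by
    have h1 := hm 0
    rw [zero_add] at h1
    exact mul_right_cancel₀ hm0 (by rw [one_mul]; exact h1.symm)
  have hfadd : ∀ a b, f (a + b, 0) = f (a, 0) * f (b, 0) := fun a b => by
    have h1 := hX a (b + t) b
    rw [show b + t + a = a + b + t by abel, show b + a = a + b from add_comm _ _, hm, hm] at h1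
    exact mul_right_cancel₀ hm0 (by rw [h1]; ring)
  -- Along the supporting shifted diagonal, the entries are a constant times a ↦ f(a, 0), a
  -- character. A finite abelian group has as many characters as elements, so the injective family
  -- `Φ` exhausts them and supplies the Z part s.
  let ψ : AddChar (Fin n → ZMod d) ℂ :=
    { toFun := fun a => f (a, 0), map_zero_eq_one' := hf0, map_add_eq_mul' := hfadd }
  let Φ : (Fin n → ZMod d) → AddChar (Fin n → ZMod d) ℂ := fun s =>
    { toFun := fun a => chi d (s ⬝ᵥ a)
      map_zero_eq_one' := by simp
      map_add_eq_mul' := fun a b => by rw [dotProduct_add, AddChar.map_add_eq_mul] }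
  have hΦ : Function.Injective Φ := by
    intro s s' hs
    funext k
    have h1 : chi d (s ⬝ᵥ Pi.single k 1) = chi d (s' ⬝ᵥ Pi.single k 1) :=
      DFunLike.congr_fun hs (Pi.single k 1)
    simpa using ZMod.injective_stdAddChar h1
  have hbij : Function.Bijective Φ :=
    (Fintype.bijective_iff_injective_and_card Φ).2 ⟨hΦ, AddChar.card_eq.symm⟩
  obtain ⟨s, hs⟩ := hbij.2 ψ
  refine ⟨U t 0, (t, s), ?_⟩
  ext x y
  rw [Matrix.smul_apply, weyl_apply, smul_eq_mul]
  split_ifs with hxy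
  · rw [hxy]
    have h1 : chi d (s ⬝ᵥ y) = f (y, 0) := DFunLike.congr_fun hs y
    simp only [h1, hm, mul_comm]
  · rw [mul_zero]
    by_contra hne
    exact hxy (hsupp x y hne)

end Pauli

/-! ### Symplectic transvections and the directions they generate -/

section Symplectic

variable {d n : ℕ}

theorem symp_add_left (u v w : Phase d n) : symp (u + v) w = symp u w + symp v w := by
  simp only [symp, Prod.fst_add, Prod.snd_add, add_dotProduct]; ring

theorem symp_add_right (u v w : Phase d n) : symp u (v + w) = symp u v + symp u w := by
  simp only [symp, Prod.fst_add, Prod.snd_add, dotProduct_add]; ring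

theorem symp_smul_left (t : ZMod d) (u v : Phase d n) : symp (t • u) v = t * symp u v := by
  simp only [symp, Prod.smul_fst, Prod.smul_snd, smul_dotProduct, smul_eq_mul]; ring

theorem symp_smul_right (t : ZMod d) (u v : Phase d n) : symp u (t • v) = t * symp u v := by
  simp only [symp, Prod.smul_fst, Prod.smul_snd, dotProduct_smul, smul_eq_mul]; ring

theorem symp_self (v : Phase d n) : symp v v = 0 := by
  rw [symp, dotProduct_comm, sub_self]

theorem symp_swap (v w : Phase d n) : symp v w = -symp w v := by
  rw [symp, symp, dotProduct_comm w.1, dotProduct_comm w.2]; ring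

theorem symp_sub_left (u v w : Phase d n) : symp (u - v) w = symp u w - symp v w := by
  simp only [symp, Prod.fst_sub, Prod.snd_sub, sub_dotProduct]; ring

/-- The vector of phase space with `i`-th coordinates `a`, `b` and all others zero. -/
def locVec (i : Fin n) (a b : ZMod d) : Phase d n := (Pi.single i a, Pi.single i b)

theorem symp_locVec_left (i : Fin n) (a b : ZMod d) (v : Phase d n) :
    symp (locVec i a b) v = a * v.2 i - b * v.1 i := by
  simp [symp, locVec]

theorem smul_locVec (i : Fin n) (t a b : ZMod d) :
    t • (locVec i a b : Phase d n) = locVec i (t * a) (t * b) := by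
  ext k <;> by_cases hk : k = i <;> simp [locVec, hk]

theorem locVec_add (i : Fin n) (a b a' b' : ZMod d) :
    (locVec i a b + locVec i a' b' : Phase d n) = locVec i (a + a') (b + b') := by
  ext k <;> by_cases hk : k = i <;> simp [locVec, hk]

/-- The symplectic transvection `w ↦ w + t ⟨u, w⟩ u`. -/
def transv (u : Phase d n) (t : ZMod d) : Phase d n ≃ₗ[ZMod d] Phase d n where
  toFun w := w + (t * symp u w) • u
  map_add' v w := by rw [symp_add_right, mul_add, add_smul]; abel
  map_smul' s w := by
    rw [symp_smul_right, RingHom.id_apply, smul_add, smul_smul, mul_left_comm]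
  invFun w := w + (-t * symp u w) • u
  left_inv w := by
    dsimp only
    rw [symp_add_right, symp_smul_right, symp_self, mul_zero, add_zero, add_assoc, ← add_smul]
    simp
  right_inv w := by
    dsimp only
    rw [symp_add_right, symp_smul_right, symp_self, mul_zero, add_zero, add_assoc, ← add_smul]
    simp

theorem transv_apply (u : Phase d n) (t : ZMod d) (w : Phase d n) :
    transv u t w = w + (t * symp u w) • u := rfl

theorem transv_add (u : Phase d n) (s t : ZMod d) :
    transv u (s + t) = transv u s * transv u t := by
  ext1 w
  rw [LinearEquiv.mul_apply, transv_apply, transv_apply, transv_apply, symp_add_right,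
    symp_smul_right, symp_self, mul_zero, add_zero, add_assoc, ← add_smul]
  congr 2; ring

theorem transv_zero_right (u : Phase d n) : transv u 0 = 1 := by
  ext1 w
  simp [transv_apply]

theorem transv_natCast_mul [NeZero d] (u : Phase d n) (t : ZMod d) (k : ℕ) :
    transv u ((k : ZMod d) * t) = transv u t ^ k := by
  induction k with
  | zero => simp [transv_zero_right]
  | succ k ih => rw [pow_succ, ← ih, ← transv_add]; congr 1; push_cast; ring

theorem transv_smul (u : Phase d n) (c t : ZMod d) : transv (c • u) t = transv u (c ^ 2 * t) := by
  ext1 w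
  rw [transv_apply, transv_apply, symp_smul_left, smul_smul]
  congr 2; ring

theorem transv_map {ρ : Phase d n ≃ₗ[ZMod d] Phase d n}
    (hρ : ∀ v w, symp (ρ v) (ρ w) = symp v w) (u : Phase d n) (t : ZMod d) :
    transv (ρ u) t = ρ * transv u t * ρ⁻¹ := by
  ext1 w
  obtain ⟨w, rfl⟩ := ρ.surjective w
  have h : ρ⁻¹ (ρ w) = w := ρ.symm_apply_apply w
  rw [LinearEquiv.mul_apply, LinearEquiv.mul_apply, h, transv_apply, transv_apply, hρ, map_add,
    map_smul]

theorem transv_symp [NeZero d] (u v w : Phase d n) (t : ZMod d) :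
    symp (transv u t v) (transv u t w) = symp v w := by
  simp only [transv_apply, symp_add_right, symp_add_left, symp_smul_left, symp_smul_right,
    symp_self]
  rw [symp_swap v u]; ring

/-- All transvections in direction `u` belong to `R`. -/
def HasTransv (R : Subgroup (Phase d n ≃ₗ[ZMod d] Phase d n)) (u : Phase d n) : Prop :=
  ∀ t, transv u t ∈ R

variable {R : Subgroup (Phase d n ≃ₗ[ZMod d] Phase d n)}

theorem HasTransv.zero : HasTransv R (0 : Phase d n) := fun t => by
  have h : transv (0 : Phase d n) t = 1 := by ext1 w; simp [transv_apply]
  rw [h]; exact one_mem _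

theorem HasTransv.smul {u : Phase d n} (h : HasTransv R u) (c : ZMod d) : HasTransv R (c • u) :=
  fun t => by rw [transv_smul]; exact h _

theorem HasTransv.map {u : Phase d n} (h : HasTransv R u)
    {ρ : Phase d n ≃ₗ[ZMod d] Phase d n} (hρR : ρ ∈ R)
    (hρ : ∀ v w, symp (ρ v) (ρ w) = symp v w) : HasTransv R (ρ u) := fun t => by
  rw [transv_map hρ]; exact mul_mem (mul_mem hρR (h t)) (inv_mem hρR)

/-- Parameters add under composition and -1 generates ℤ/d additively. The value -1 is the one
realised by the gate S. -/
theorem HasTransv.of_transv_mem [NeZero d] {u : Phase d n}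
    (h : transv u (-1) ∈ R) : HasTransv R u := fun t => by
  have h1 := transv_natCast_mul u (-1) (-t).val
  rw [ZMod.natCast_zmod_val, neg_mul_neg, mul_one] at h1
  rw [h1]; exact pow_mem h _

variable [Fact d.Prime]

/-- The transvection along u with parameter ⟨u, v⟩⁻¹ carries v to v + u, and conjugating by it
carries transvections along v to transvections along v + u. -/
theorem HasTransv.add_iff {u v : Phase d n} (hu : HasTransv R u) (huv : symp u v ≠ 0) :
    HasTransv R (v + u) ↔ HasTransv R v := by
  constructor
  · intro h
    have h1 := h.map (hu (-(symp u v)⁻¹)) fun _ _ => transv_symp _ _ _ _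
    rw [transv_apply, symp_add_right, symp_self, add_zero, neg_mul, inv_mul_cancel₀ huv] at h1
    simpa using h1
  · intro h
    have h1 := h.map (hu (symp u v)⁻¹) fun _ _ => transv_symp _ _ _ _
    rw [transv_apply, inv_mul_cancel₀ huv, one_smul] at h1
    exact h1

theorem hasTransv_locVec {i : Fin n} (hx : HasTransv R (locVec i 1 0))
    (hz : HasTransv R (locVec i 0 1)) (a b : ZMod d) : HasTransv R (locVec i a b) := by
  have hxa : HasTransv R (locVec i a 0) := by simpa [smul_locVec] using hx.smul a
  have hzb : HasTransv R (locVec i 0 b) := by simpa [smul_locVec] using hz.smul b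
  by_cases ha : a = 0
  · rw [ha]; exact hzb
  by_cases hb : b = 0
  · rw [hb]; exact hxa
  have h := (hzb.add_iff (v := locVec i a 0)
    (by rw [symp_locVec_left]; simp [locVec, ha, hb])).2 hxa
  simpa [locVec_add] using h

/-- Having transvections does not depend on the value of a nonzero local component. -/
theorem hasTransv_congr_local {i : Fin n} (hx : HasTransv R (locVec i 1 0))
    (hz : HasTransv R (locVec i 0 1)) {v v' : Phase d n}
    (hv : ¬(v.1 i = 0 ∧ v.2 i = 0)) (hv' : ¬(v'.1 i = 0 ∧ v'.2 i = 0))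
    (h : ∀ k, k ≠ i → v.1 k = v'.1 k ∧ v.2 k = v'.2 k) : HasTransv R v ↔ HasTransv R v' := by
  have hloc := hasTransv_locVec hx hz
  have hdiff : v' = v + locVec i (v'.1 i - v.1 i) (v'.2 i - v.2 i) := by
    ext k <;> by_cases hk : k = i
    · subst hk; simp [locVec]
    · simp [locVec, hk, h k hk]
    · subst hk; simp [locVec]
    · simp [locVec, hk, h k hk]
  by_cases hs : symp (locVec i (v'.1 i - v.1 i) (v'.2 i - v.2 i)) v = 0
  · rw [symp_locVec_left] at hs
    -- The local parts of v and v' are parallel here, so one addition cannot link them. The detour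
    -- through v + (a, b) works when (a, b) is orthogonal to neither local part; a coordinate
    -- direction will do.
    obtain ⟨a, b, hw, hw'⟩ : ∃ a b, a * v.2 i - b * v.1 i ≠ 0 ∧ a * v'.2 i - b * v'.1 i ≠ 0 := by
      by_cases h2 : v.2 i = 0
      · have h1 : v.1 i ≠ 0 := fun h1 => hv ⟨h1, h2⟩
        refine ⟨0, 1, by simpa using h1, ?_⟩
        simp only [zero_mul, one_mul, zero_sub, ne_eq, neg_eq_zero]
        intro h1'
        rw [h2, mul_zero, zero_sub, neg_eq_zero, sub_zero, mul_eq_zero, or_iff_left h1] at hs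
        exact hv' ⟨h1', hs⟩
      · refine ⟨1, 0, by simpa using h2, ?_⟩
        simp only [zero_mul, one_mul, sub_zero, ne_eq]
        intro h2'
        rw [h2'] at hs
        have h3 : v'.1 i * v.2 i = 0 := by linear_combination hs
        exact hv' ⟨(mul_eq_zero.1 h3).resolve_right h2, h2'⟩
    rw [← (hloc a b).add_iff (v := v) (by rwa [symp_locVec_left]),
      ← (hloc (v'.1 i - v.1 i - a) (v'.2 i - v.2 i - b)).add_iff (v := v + locVec i a b),
      add_assoc, locVec_add, add_sub_cancel, add_sub_cancel, ← hdiff]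
    rw [symp_locVec_left]
    simp only [locVec, Prod.fst_add, Prod.snd_add, Pi.add_apply, Pi.single_eq_same]
    intro h0
    apply hw'
    linear_combination -h0 + hs
  · rw [hdiff, (hloc _ _).add_iff hs]

/-- A discrete intermediate value argument; it is what lets neighbouring C_X gates suffice. -/
theorem exists_succ_not_iff {p : Fin n → Prop} (h : ∃ i, p i) (h' : ∃ i, ¬p i) :
    ∃ i j : Fin n, i.val + 1 = j.val ∧ ¬(p i ↔ p j) := by
  by_contra! hc
  obtain ⟨i, hi⟩ := h
  obtain ⟨j, hj⟩ := h'
  have key : ∀ k (hk : k < n), p ⟨k, hk⟩ ↔ p ⟨0, by omega⟩ := by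
    intro k
    induction k with
    | zero => intro _; rfl
    | succ k ih => intro hk; rw [← ih (by omega)]; exact (hc ⟨k, by omega⟩ ⟨k + 1, hk⟩ rfl).symm
  exact hj ((key j.1 j.2).2 ((key i.1 i.2).1 hi))

/-- The set of qudits at which a phase space vector vanishes. -/
def zeros (v : Phase d n) : Finset (Fin n) :=
  Finset.univ.filter fun k => v.1 k = 0 ∧ v.2 k = 0

theorem mem_zeros {v : Phase d n} {k : Fin n} : k ∈ zeros v ↔ v.1 k = 0 ∧ v.2 k = 0 := by
  simp [zeros]

/-- Normalise the component at i to (0, 1), which pairs to 1 with x_i + x_j because v vanishes at j.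
Adding x_i + x_j then gives (1, 1) at i and (1, 0) at j, filling the zero at j. -/
theorem exists_card_zeros_lt (hx : ∀ i, HasTransv R (locVec i 1 0))
    (hz : ∀ i, HasTransv R (locVec i 0 1)) {i j : Fin n} (hij : i ≠ j)
    (hxx : HasTransv R (locVec i 1 0 + locVec j 1 0)) {v : Phase d n} (hi : i ∉ zeros v)
    (hj : j ∈ zeros v) :
    ∃ v' : Phase d n, (HasTransv R v ↔ HasTransv R v') ∧ zeros v' ⊂ zeros v := by
  rw [mem_zeros] at hi hj
  set v₀ : Phase d n := (Function.update v.1 i 0, Function.update v.2 i 1) with hv₀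
  have h0 : HasTransv R v ↔ HasTransv R v₀ :=
    hasTransv_congr_local (hx i) (hz i) hi (by simp [hv₀])
      fun k hk => by simp [hv₀, hk]
  have hs : symp (locVec i 1 0 + locVec j 1 0) v₀ ≠ 0 := by
    rw [symp_add_left, symp_locVec_left, symp_locVec_left]
    simp [hv₀, hij.symm, hj.2]
  refine ⟨v₀ + (locVec i 1 0 + locVec j 1 0), by rw [h0, hxx.add_iff hs], ?_⟩
  rw [Finset.ssubset_iff_of_subset]
  · refine ⟨j, mem_zeros.2 hj, ?_⟩
    rw [mem_zeros]
    simp [hv₀, locVec, hij.symm, hj.1]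
  · intro k hk
    rw [mem_zeros] at hk ⊢
    by_cases hki : k = i
    · subst hki; simp [hv₀, locVec, hij] at hk
    · by_cases hkj : k = j
      · rw [hkj]; exact hj
      · simpa [hv₀, locVec, hki, hkj] using hk

theorem hasTransv_iff_of_zeros_eq_empty (hx : ∀ i, HasTransv R (locVec i 1 0))
    (hz : ∀ i, HasTransv R (locVec i 0 1)) {v : Phase d n} (hv : zeros v = ∅) :
    HasTransv R v ↔ HasTransv R (0, 1) := by
  have hv' : ∀ k, ¬(v.1 k = 0 ∧ v.2 k = 0) := fun k hk => by
    have := mem_zeros.2 hk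
    simp [hv] at this
  have key : ∀ s : Finset (Fin n),
      HasTransv R v ↔ HasTransv R (s.piecewise 0 v.1, s.piecewise 1 v.2) := by
    intro s
    induction s using Finset.induction_on with
    | empty => simp
    | insert i s hi ih =>
      rw [ih]
      refine hasTransv_congr_local (hx i) (hz i) ?_ ?_ fun k hk => ?_
      · simpa [hi] using hv' i
      · simp
      · by_cases hks : k ∈ s <;> simp [hk, hks]
  simpa using key Finset.univ

/-- Filling zeros one at a time links every nonzero vector to the one with component (0, 1)
everywhere. The given Z-directions are among the linked vectors, so all of them have transvections.
-/
theorem hasTransv_of_generators (hx : ∀ i, HasTransv R (locVec i 1 0))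
    (hz : ∀ i, HasTransv R (locVec i 0 1))
    (hxx : ∀ i j : Fin n, i.val + 1 = j.val → HasTransv R (locVec i 1 0 + locVec j 1 0))
    (v : Phase d n) : HasTransv R v := by
  have key : ∀ (m : ℕ) (v : Phase d n), (zeros v).card = m → v ≠ 0 →
      (HasTransv R v ↔ HasTransv R (0, 1)) := by
    intro m
    induction m using Nat.strong_induction_on with
    | _ m ih =>
      intro v hm hv
      have hex : ∃ i, i ∉ zeros v := by
        by_contra! hc
        simp only [mem_zeros] at hc
        exact hv (Prod.ext (funext fun k => (hc k).1) (funext fun k => (hc k).2))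
      by_cases hemp : zeros v = ∅
      · exact hasTransv_iff_of_zeros_eq_empty hx hz hemp
      · obtain ⟨k, hk⟩ := Finset.nonempty_iff_ne_empty.2 hemp
        obtain ⟨i, j, hij, hne⟩ := exists_succ_not_iff hex ⟨k, not_not.2 hk⟩
        have hij' : i ≠ j := fun h => by rw [h] at hij; omega
        have hstep : ∃ v' : Phase d n, (HasTransv R v ↔ HasTransv R v') ∧ zeros v' ⊂ zeros v := by
          by_cases hi : i ∈ zeros v
          · refine exists_card_zeros_lt hx hz hij'.symm ?_ (by tauto) hi
            rw [add_comm]; exact hxx i j hij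
          · exact exists_card_zeros_lt hx hz hij' (hxx i j hij) hi (by tauto)
        obtain ⟨v', hiff, hlt⟩ := hstep
        have hv' : v' ≠ 0 := by
          rintro rfl
          have : zeros (0 : Phase d n) = Finset.univ := by ext k; simp [mem_zeros]
          rw [this] at hlt
          exact hlt.2 (Finset.subset_univ _)
        rw [hiff]
        exact ih _ (hm ▸ Finset.card_lt_card hlt) v' rfl hv'
  by_cases hv : v = 0
  · rw [hv]; exact HasTransv.zero
  · obtain ⟨i⟩ : Nonempty (Fin n) := by
      by_contra hc
      rw [not_nonempty_iff] at hc
      exact hv (Subsingleton.elim _ _)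
    have hi : (locVec i 0 1 : Phase d n) ≠ 0 := fun h => by
      have := congrFun (congrArg Prod.snd h) i
      simp [locVec] at this
    rw [key _ v rfl hv, ← key _ _ rfl hi]
    exact hz i

/-! ### Moving symplectic families to the standard one -/

/-- Since ⟨u - v, u⟩ = ⟨u, v⟩, the transvection along u - v with parameter -⟨u, v⟩⁻¹ subtracts
exactly u - v from u. It fixes whatever is orthogonal to u - v. -/
theorem exists_mem_map_eq_of_symp_ne_zero (hR : ∀ u, HasTransv R u) {u v : Phase d n}
    (h : symp u v ≠ 0) :
    ∃ ρ ∈ R, (∀ a b, symp (ρ a) (ρ b) = symp a b) ∧ ρ u = v ∧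
      ∀ w, symp u w = symp v w → ρ w = w := by
  refine ⟨transv (u - v) (-(symp u v)⁻¹), hR _ _, fun _ _ => transv_symp _ _ _ _, ?_, fun w hw => ?_⟩
  · rw [transv_apply, symp_sub_left, symp_self, symp_swap v u, sub_neg_eq_add, zero_add,
      neg_mul, inv_mul_cancel₀ h, neg_smul, one_smul]
    abel
  · rw [transv_apply, symp_sub_left, hw]
    simp

theorem exists_mem_map_eq_of_bridge (hR : ∀ u, HasTransv R u) {u v w : Phase d n}
    (huw : symp u w ≠ 0) (hwv : symp w v ≠ 0) :
    ∃ ρ ∈ R, (∀ a b, symp (ρ a) (ρ b) = symp a b) ∧ ρ u = v ∧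
      ∀ x, symp u x = symp v x → symp w x = symp v x → ρ x = x := by
  obtain ⟨ρ, hρ, hρs, hu, hfix⟩ := exists_mem_map_eq_of_symp_ne_zero hR huw
  obtain ⟨ρ', hρ', hρs', hw, hfix'⟩ := exists_mem_map_eq_of_symp_ne_zero hR hwv
  refine ⟨ρ' * ρ, mul_mem hρ' hρ, fun a b => ?_, ?_, fun x hx hx' => ?_⟩
  · rw [LinearEquiv.mul_apply, LinearEquiv.mul_apply, hρs', hρs]
  · rw [LinearEquiv.mul_apply, hu, hw]
  · rw [LinearEquiv.mul_apply, hfix x (hx.trans hx'.symm), hfix' x hx']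

/-- A hyperbolic pair can be moved to another one, fixing everything orthogonal to both. -/
theorem exists_mem_map_pair (hR : ∀ u, HasTransv R u) {e f e' f' : Phase d n}
    (h : symp e f = 1) (h' : symp e' f' = 1) :
    ∃ ρ ∈ R, (∀ a b, symp (ρ a) (ρ b) = symp a b) ∧ ρ e = e' ∧ ρ f = f' ∧
      ∀ x, symp e x = 0 → symp f x = 0 → symp e' x = 0 → symp f' x = 0 → ρ x = x := by
  have step₁ : ∃ ρ ∈ R, (∀ a b, symp (ρ a) (ρ b) = symp a b) ∧ ρ e = e' ∧
      ∀ x, symp e x = 0 → symp f x = 0 → symp e' x = 0 → symp f' x = 0 → ρ x = x := by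
    by_cases h1 : symp e e' = 0
    -- The bridge w is taken among f, f' and f + f', so that vectors orthogonal to both f and f'
    -- stay fixed.
    · obtain ⟨w, hew, hwe, hw⟩ : ∃ w, symp e w ≠ 0 ∧ symp w e' ≠ 0 ∧
          ∀ x, symp f x = 0 → symp f' x = 0 → symp w x = 0 := by
        by_cases h2 : symp e f' = 0
        · by_cases h3 : symp f e' = 0
          · refine ⟨f + f', ?_, ?_, fun x hx hx' => ?_⟩
            · simp [symp_add_right, h, h2]
            · simp [symp_add_left, h3, symp_swap f' e', h']
            · rw [symp_add_left, hx, hx', add_zero]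
          · exact ⟨f, by simp [h], h3, fun x hx _ => hx⟩
        · exact ⟨f', h2, by simp [symp_swap f' e', h'], fun x _ hx => hx⟩
      obtain ⟨ρ, hρ, hρs, hu, hfix⟩ := exists_mem_map_eq_of_bridge hR hew hwe
      exact ⟨ρ, hρ, hρs, hu, fun x a b c d =>
        hfix x (a.trans c.symm) ((hw x b d).trans c.symm)⟩
    · obtain ⟨ρ, hρ, hρs, hu, hfix⟩ := exists_mem_map_eq_of_symp_ne_zero hR h1
      exact ⟨ρ, hρ, hρs, hu, fun x a _ c _ => hfix x (a.trans c.symm)⟩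
  have step₂ : ∀ g, symp e' g = 1 →
      ∃ ρ ∈ R, (∀ a b, symp (ρ a) (ρ b) = symp a b) ∧ ρ g = f' ∧ ρ e' = e' ∧
      ∀ x, symp g x = 0 → symp e' x = 0 → symp f' x = 0 → ρ x = x := by
    intro g hg
    have hge : symp g e' = symp f' e' := by rw [symp_swap, hg, symp_swap f', h']
    by_cases h1 : symp g f' = 0
    -- The bridge e' + g pairs with e' exactly as g and f' do, so both transvections fix e'.
    · have h2 : symp g (e' + g) ≠ 0 := by
        rw [symp_add_right, symp_self, symp_swap, hg]; simp
      have h3 : symp (e' + g) f' ≠ 0 := by rw [symp_add_left, h1, h']; simp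
      obtain ⟨ρ, hρ, hρs, hu, hfix⟩ := exists_mem_map_eq_of_bridge hR h2 h3
      refine ⟨ρ, hρ, hρs, hu, hfix e' hge ?_, fun x a b c => hfix x (a.trans c.symm) ?_⟩
      · rw [symp_add_left, symp_self, zero_add, hge]
      · rw [symp_add_left, a, b, c, add_zero]
    · obtain ⟨ρ, hρ, hρs, hu, hfix⟩ := exists_mem_map_eq_of_symp_ne_zero hR h1
      exact ⟨ρ, hρ, hρs, hu, hfix e' hge, fun x a _ c => hfix x (a.trans c.symm)⟩
  obtain ⟨ρ, hρ, hρs, hu, hfix⟩ := step₁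
  obtain ⟨ρ', hρ', hρs', hu', he', hfix'⟩ := step₂ (ρ f) (by rw [← hu, hρs, h])
  refine ⟨ρ' * ρ, mul_mem hρ' hρ, fun a b => ?_, ?_, ?_, fun x a b c d => ?_⟩
  · rw [LinearEquiv.mul_apply, LinearEquiv.mul_apply, hρs', hρs]
  · rw [LinearEquiv.mul_apply, hu, he']
  · rw [LinearEquiv.mul_apply, hu']
  · have hx := hfix x a b c d
    rw [LinearEquiv.mul_apply, hx]
    refine hfix' x ?_ c d
    rw [← hρs, hx] at b
    exact b

/-- Pairs are moved one at a time. Those already standard are orthogonal to both the source and the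
target of the next move, which therefore fixes them. -/
theorem exists_mem_map_standard (hR : ∀ u, HasTransv R u) {e f : Fin n → Phase d n}
    (hee : ∀ i j, symp (e i) (e j) = 0) (hff : ∀ i j, symp (f i) (f j) = 0)
    (hef : ∀ i j, symp (e i) (f j) = if i = j then 1 else 0) :
    ∃ ρ ∈ R, ∀ i, ρ (e i) = locVec i 1 0 ∧ ρ (f i) = locVec i 0 1 := by
  have key : ∀ s : Finset (Fin n), ∃ ρ ∈ R, (∀ a b, symp (ρ a) (ρ b) = symp a b) ∧
      ∀ i ∈ s, ρ (e i) = locVec i 1 0 ∧ ρ (f i) = locVec i 0 1 := by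
    intro s
    induction s using Finset.induction_on with
    | empty => exact ⟨1, one_mem _, fun _ _ => rfl, by simp⟩
    | insert j s hj ih =>
      obtain ⟨ρ, hρ, hρs, hfix⟩ := ih
      obtain ⟨τ, hτ, hτs, he, hf, hτfix⟩ := exists_mem_map_pair hR
        (e := ρ (e j)) (f := ρ (f j)) (e' := locVec j 1 0) (f' := locVec j 0 1)
        (by rw [hρs, hef, if_pos rfl]) (by rw [symp_locVec_left]; simp [locVec])
      refine ⟨τ * ρ, mul_mem hτ hρ, fun a b => ?_, fun i hi => ?_⟩
      · rw [LinearEquiv.mul_apply, LinearEquiv.mul_apply, hτs, hρs]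
      · rw [LinearEquiv.mul_apply, LinearEquiv.mul_apply]
        rw [Finset.mem_insert] at hi
        rcases hi with rfl | hi
        · exact ⟨he, hf⟩
        · have hji : j ≠ i := fun h => hj (h ▸ hi)
          obtain ⟨h1, h2⟩ := hfix i hi
          have h3 : τ (ρ (e i)) = ρ (e i) := by
            refine hτfix _ ?_ ?_ ?_ ?_
            · rw [hρs, hee]
            · rw [hρs, symp_swap, hef, if_neg hji.symm, neg_zero]
            · rw [h1, symp_locVec_left]; simp [locVec]
            · rw [h1, symp_locVec_left]; simp [locVec, hji]
          have h4 : τ (ρ (f i)) = ρ (f i) := by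
            refine hτfix _ ?_ ?_ ?_ ?_
            · rw [hρs, hef, if_neg hji]
            · rw [hρs, hff]
            · rw [h2, symp_locVec_left]; simp [locVec, hji]
            · rw [h2, symp_locVec_left]; simp [locVec]
          rw [h3, h4]
          exact hfix i hi
  obtain ⟨ρ, hρ, -, h⟩ := key Finset.univ
  exact ⟨ρ, hρ, fun i => h i (Finset.mem_univ i)⟩

end Symplectic

/-! ### Circuits realise every Clifford operator up to phase -/

section Generation

variable {d n : ℕ} [Fact d.Prime]

/-- The linear automorphisms of phase space implemented by circuits. -/
def implemented (d n : ℕ) [Fact d.Prime] (E : Fin n → Fin n → Prop) :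
    Subgroup (Phase d n ≃ₗ[ZMod d] Phase d n) where
  carrier := {σ | ∃ U ∈ circuits d n E, ∀ v, Maps U v (σ v)}
  one_mem' := ⟨1, one_mem _, Maps.one⟩
  mul_mem' := by
    rintro σ τ ⟨U, hU, h⟩ ⟨U', hU', h'⟩
    exact ⟨U * U', mul_mem hU hU', fun v => (h (τ v)).mul (h' v)⟩
  inv_mem' := by
    rintro σ ⟨U, hU, h⟩
    -- Circuits contain no inverse gates, but in a finite group σ⁻¹ is a natural power of σ, hence
    -- implemented by a power of U.
    have hfin : Finite (Phase d n ≃ₗ[ZMod d] Phase d n) := DFunLike.finite _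
    have hpow : ∀ k : ℕ, ∀ v, Maps (U ^ k) v ((σ ^ k) v) := by
      intro k
      induction k with
      | zero => intro v; simpa using Maps.one v
      | succ k ih => intro v; rw [pow_succ, pow_succ]; exact (ih (σ v)).mul (h v)
    obtain ⟨k, hk⟩ := (isOfFinOrder_of_finite σ).mem_powers_iff_mem_zpowers.2
      (inv_mem (Subgroup.mem_zpowers σ))
    exact ⟨U ^ k, pow_mem hU k, fun v => by rw [← hk]; exact hpow k v⟩

variable {E : Fin n → Fin n → Prop}

theorem symp_of_mem_implemented (hd : Odd d) {σ : Phase d n ≃ₗ[ZMod d] Phase d n}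
    (hσ : σ ∈ implemented d n E) (v w : Phase d n) : symp (σ v) (σ w) = symp v w := by
  obtain ⟨U, hU, h⟩ := hσ
  exact (Maps.symp_eq (mem_clifford_iff.1 (circuits_subset_clifford hd hU)).1 (h v) (h w)).symm

/-- Conjugation by a unitary cannot identify distinct Weyl operators up to phase, so f is injective,
hence bijective on a finite-dimensional space. -/
theorem exists_mem_implemented (hd : Odd d) {U : Op d n} (hU : U ∈ circuits d n E)
    (f : Phase d n →ₗ[ZMod d] Phase d n) (hf : ∀ v, Maps U v (f v)) :
    ∃ σ ∈ implemented d n E, ∀ v, σ v = f v := by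
  have hUu := (mem_clifford_iff.1 (circuits_subset_clifford hd hU)).1
  have hinj : Function.Injective f := fun v w h =>
    Maps.eq_of_eq hUu (hf v) (by rw [h]; exact hf w)
  exact ⟨LinearEquiv.ofInjectiveEndo f hinj, ⟨U, hU, hf⟩, fun _ => rfl⟩

theorem hasTransv_implemented_z (hd : Odd d) (i : Fin n) :
    HasTransv (implemented d n E) (locVec i 0 1) := by
  refine HasTransv.of_transv_mem ⟨onQudit i (matS d),
    onQudit_mem_circuits i (Submonoid.subset_closure (by simp)), fun v => ?_⟩
  convert maps_onQudit_matS hd i v using 1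
  rw [transv_apply, symp_locVec_left, smul_locVec]
  ext k <;> simp [locVec]

/-- The action of the Fourier gate on phase space. -/
def fourierMap (i : Fin n) : Phase d n →ₗ[ZMod d] Phase d n where
  toFun v := (Function.update v.1 i (-v.2 i), Function.update v.2 i (v.1 i))
  map_add' v w := by
    ext k <;> by_cases hk : k = i
    · subst hk; simp [add_comm]
    · simp [hk]
    · subst hk; simp
    · simp [hk]
  map_smul' t v := by
    ext k <;> by_cases hk : k = i
    · subst hk; simp
    · simp [hk]
    · subst hk; simp
    · simp [hk]

/-- The action of the controlled shift on phase space. -/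
def shiftMap (i j : Fin n) : Phase d n →ₗ[ZMod d] Phase d n where
  toFun v := (v.1 + Pi.single j (v.1 i), v.2 - Pi.single i (v.2 j))
  map_add' v w := by
    ext k <;> simp [Pi.single_add] <;> ring
  map_smul' t v := by
    ext k <;> simp [smul_sub, Pi.single_apply]

theorem hasTransv_implemented_x (hd : Odd d) (i : Fin n) :
    HasTransv (implemented d n E) (locVec i 1 0) := by
  obtain ⟨σ, hσ, h⟩ := exists_mem_implemented (E := E) hd
    (onQudit_mem_circuits i (Submonoid.subset_closure (by simp))) (fourierMap i)
    (maps_onQudit_matF i)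
  -- F sends the Z-direction to minus the X-direction; the scalar -1 corrects the sign.
  have h1 := ((hasTransv_implemented_z hd i).map hσ (symp_of_mem_implemented hd hσ)).smul (-1)
  convert h1 using 1
  rw [h]
  ext k <;> by_cases hk : k = i
  · subst hk; simp [fourierMap, locVec]
  · simp [fourierMap, locVec, hk]
  · subst hk; simp [fourierMap, locVec]
  · simp [fourierMap, locVec, hk]

theorem hasTransv_implemented_add (hd : Odd d) {i j : Fin n} (hij : i ≠ j) (hE : E i j) :
    HasTransv (implemented d n E) (locVec i 1 0 + locVec j 1 0) := by
  obtain ⟨σ, hσ, h⟩ := exists_mem_implemented (E := E) hd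
    (Submonoid.subset_closure (Or.inr (Or.inr ⟨i, j, hij, hE, rfl⟩))) (shiftMap i j)
    (maps_onPair_matCX hij)
  have h1 := (hasTransv_implemented_x hd i).map hσ (symp_of_mem_implemented hd hσ)
  convert h1 using 1
  rw [h]
  ext k <;> simp [shiftMap, locVec]

theorem maps_self_of_generators {U : Op d n} (hx : ∀ i, Maps U (locVec i 1 0) (locVec i 1 0))
    (hz : ∀ i, Maps U (locVec i 0 1) (locVec i 0 1)) (v : Phase d n) : Maps U v v := by
  have hsum : ∀ s : Finset (Fin n), Maps U
      (∑ i ∈ s, (v.1 i • locVec i 1 0 + v.2 i • locVec i 0 1))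
      (∑ i ∈ s, (v.1 i • locVec i 1 0 + v.2 i • locVec i 0 1)) := by
    intro s
    induction s using Finset.induction_on with
    | empty => simpa using Maps.zero U
    | insert i s hi ih =>
      rw [Finset.sum_insert hi]
      exact (((hx i).smul _).add ((hz i).smul _)).add ih
  have hv : v = ∑ i, (v.1 i • locVec i 1 0 + v.2 i • locVec i 0 1) := by
    ext k <;> simp [Prod.fst_sum, Prod.snd_sum, locVec, Finset.sum_apply, Pi.single_apply]
  rw [hv]
  exact hsum _

theorem Maps.star {U : Op d n} (hU : U ∈ Matrix.unitaryGroup (Fin n → ZMod d) ℂ)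
    {v w : Phase d n} (h : Maps U v w) : Maps (star U) w v := by
  obtain ⟨c, hc, e⟩ := h.conj hU
  refine ⟨c⁻¹, ?_⟩
  have h1 : weyl w = c⁻¹ • (U * weyl v * Star.star U) := by
    rw [e, smul_smul, inv_mul_cancel₀ hc, one_smul]
  rw [h1, mul_smul_comm, ← mul_assoc, ← mul_assoc, Matrix.mem_unitaryGroup_iff'.1 hU, one_mul]

theorem clifford_subset_circuitsUpToPhase (hd : Odd d)
    (hE : ∀ i j : Fin n, i.val + 1 = j.val → E i j) :
    clifford d n ⊆ circuitsUpToPhase d n E := by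
  intro U hU
  obtain ⟨hUu, hU⟩ := mem_clifford_iff.1 hU
  -- Linearity of σ is never needed: only its values on the standard basis and the invariance of the
  -- form are used.
  choose σ hσ using hU
  have hsymp : ∀ v w, symp (σ v) (σ w) = symp v w := fun v w =>
    (Maps.symp_eq hUu (hσ v) (hσ w)).symm
  have hR : ∀ u, HasTransv (implemented d n E) u :=
    hasTransv_of_generators (hasTransv_implemented_x hd) (hasTransv_implemented_z hd)
      fun i j hij => hasTransv_implemented_add hd
        (fun h => by rw [h] at hij; omega) (hE i j hij)
  obtain ⟨ρ, hρ, h⟩ := exists_mem_map_standard hR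
    (e := fun i => σ (locVec i 1 0)) (f := fun i => σ (locVec i 0 1))
    (fun i j => by rw [hsymp, symp_locVec_left]; simp [locVec])
    (fun i j => by rw [hsymp, symp_locVec_left]; simp [locVec])
    (fun i j => by rw [hsymp, symp_locVec_left]; simp [locVec, Pi.single_apply])
  -- C implements ρ⁻¹, which sends each standard basis vector to its image under σ; thus C†U fixes
  -- the basis.
  obtain ⟨C, hC, hCρ⟩ := inv_mem hρ
  have hCu := (mem_clifford_iff.1 (circuits_subset_clifford hd hC)).1
  have hback : ∀ v, ρ⁻¹ (ρ v) = v := fun v => ρ.symm_apply_apply v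
  have hMu : star C * U ∈ Matrix.unitaryGroup (Fin n → ZMod d) ℂ :=
    mul_mem (Unitary.star_mem hCu) hUu
  have hM : ∀ v, Maps (star C * U) v v := by
    refine maps_self_of_generators (fun i => ?_) fun i => ?_
    · have h1 := hCρ (ρ (σ (locVec i 1 0)))
      rw [hback, (h i).1] at h1
      exact (h1.star hCu).mul (hσ _)
    · have h1 := hCρ (ρ (σ (locVec i 0 1)))
      rw [hback, (h i).2] at h1
      exact (h1.star hCu).mul (hσ _)
  obtain ⟨c, v, hcv⟩ := exists_eq_smul_weyl_of_maps_self hMu hM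
  have hUeq : U = c • (C * weyl v) := by
    rw [← mul_smul_comm, ← hcv, ← mul_assoc, Matrix.mem_unitaryGroup_iff.1 hCu, one_mul]
  refine ⟨c, ?_, C * weyl v, mul_mem hC (weyl_mem_circuits hd v), hUeq⟩
  exact norm_eq_one_of_smul_mem (mul_mem hCu (weyl_mem_unitaryGroup v)) (hUeq ▸ hUu)

end Generation

end Qudit

theorem mainTheorem1 (d n : ℕ) [Fact d.Prime] (hd : Odd d) :
    Qudit.clifford d n = Qudit.circuitsUpToPhase d n (fun _ _ => True) ∧
    Qudit.clifford d n = Qudit.circuitsUpToPhase d n (fun i j => i.val + 1 = j.val) :=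
  ⟨(Qudit.clifford_subset_circuitsUpToPhase hd fun _ _ _ => trivial).antisymm
      (Qudit.circuitsUpToPhase_subset_clifford hd _),
    (Qudit.clifford_subset_circuitsUpToPhase hd fun _ _ h => h).antisymm
      (Qudit.circuitsUpToPhase_subset_clifford hd _)⟩
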